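/- Let $\mathcal S(\mathbb R)$ be the Schwartz space of rapidly decreasing smooth functions $f:\mathbb R\to\mathbb C$ with its usual Fréchet topology. Let $\varphi$ be a polynomial with real coefficients and degree greater than or equal to two, and let $C_\varphi:\mathcal S(\mathbb R)\to\mathcal S(\mathbb R)$, $C_\varphi f=f\circ\varphi$, be the (well defined, continuous, linear) composition operator with symbol $\varphi$. Then the following are equivalent: (1) $C_\varphi$ is power bounded, i.e. the set of iterates $\{C_\varphi^n : n\in\mathbb N\}$ is equicontinuous. (2) $C_\varphi$ is mean ergodic, i.e. there is a continuous linear operator $P$ on $\mathcal S(\mathbb R)$ such that $\frac1n\sum_{k=1}^n C_\varphi^k f\to Pf$ in $\mathcal S(\mathbb R)$ as $n\to\infty$, for every $f\in\mathcal S(\mathbb R)$. (3) The degree of $\varphi$ is even and $\varphi$ has no fixed points, i.e. $\varphi(x)\ne x$ for every $x\in\mathbb R$. -/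

import Mathlib

open scoped SchwartzMap Topology Polynomial

/-- A continuous linear operator `T` is power bounded if the family of its powers
`{T ^ n : n ∈ ℕ}` is equicontinuous. -/
def IsPowerBounded {𝕜 X : Type*} [RCLike 𝕜] [AddCommGroup X] [Module 𝕜 X]
    [UniformSpace X] [IsUniformAddGroup X] (T : X →L[𝕜] X) : Prop :=
  Equicontinuous (fun (n : ℕ) (x : X) => (T ^ n) x)

/-- The value at `x` of the `n`-th Cesàro mean `T_{[n]} = (T + T ^ 2 + ⋯ + T ^ n) / n`. -/
noncomputable def cesaroMean {𝕜 X : Type*} [RCLike 𝕜] [AddCommGroup X] [Module 𝕜 X]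
    [TopologicalSpace X] (T : X →L[𝕜] X) (n : ℕ) (x : X) : X :=
  (n : 𝕜)⁻¹ • ∑ k ∈ Finset.Icc 1 n, (T ^ k) x

/-- A continuous linear operator `T` is mean ergodic if its Cesàro means converge in the strong
operator topology (pointwise on `X`) to some continuous linear operator `P`. -/
def IsMeanErgodic {𝕜 X : Type*} [RCLike 𝕜] [AddCommGroup X] [Module 𝕜 X]
    [TopologicalSpace X] (T : X →L[𝕜] X) : Prop :=
  ∃ P : X →L[𝕜] X, ∀ x : X,
    Filter.Tendsto (fun n : ℕ => cesaroMean T n x) Filter.atTop (𝓝 (P x))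

theorem Polynomial.hasTemperateGrowth_eval (φ : ℝ[X]) :
    Function.HasTemperateGrowth (fun x : ℝ => φ.eval x) := by
  induction φ using Polynomial.induction_on' with
  | add p q hp hq =>
    have := hp.add hq
    simpa [Pi.add_def] using this
  | monomial n a =>
    have := (Function.HasTemperateGrowth.const (E := ℝ) a).mul
      ((Function.HasTemperateGrowth.id' (E := ℝ)).pow n)
    simpa [Pi.mul_def, Pi.pow_def] using this

theorem Polynomial.exists_norm_le_of_one_le_natDegree (φ : ℝ[X]) (hφ : 1 ≤ φ.natDegree) :
    ∃ (k : ℕ) (C : ℝ), ∀ x : ℝ, ‖x‖ ≤ C * (1 + ‖φ.eval x‖) ^ k := by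
  have hq : φ.divX ≠ 0 := by
    intro h
    rw [Polynomial.divX_eq_zero_iff] at h
    rw [h, Polynomial.natDegree_C] at hφ
    omega
  obtain ⟨δ, hδ, hev⟩ : ∃ δ : ℝ, 0 < δ ∧
      ∀ᶠ x in Filter.cocompact ℝ, δ ≤ ‖φ.divX.eval x‖ := by
    rcases Nat.eq_zero_or_pos φ.divX.natDegree with h0 | h0
    · rw [Polynomial.natDegree_eq_zero] at h0
      obtain ⟨c, hc⟩ := h0
      rw [← hc] at hq ⊢
      refine ⟨‖c‖, ?_, by simp⟩
      simpa using hq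
    · exact ⟨1, one_pos, (Polynomial.tendsto_norm_atTop φ.divX
        (Polynomial.natDegree_pos_iff_degree_pos.mp h0)
        (tendsto_norm_cocompact_atTop (E := ℝ))).eventually_ge_atTop 1⟩
  obtain ⟨R, hK, hR⟩ := Filter.hasBasis_cocompact.eventually_iff.mp hev
  obtain ⟨M, hM⟩ := hK.isBounded.exists_norm_le
  refine ⟨1, |M| + (1 + |φ.coeff 0|) / δ, fun x => ?_⟩
  have hc : 0 ≤ (1 + |φ.coeff 0|) / δ := by positivity
  have hn : 0 ≤ ‖φ.eval x‖ := norm_nonneg _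
  by_cases hx : x ∈ R
  · have h1 : ‖x‖ ≤ |M| := (hM x hx).trans (le_abs_self M)
    nlinarith [abs_nonneg M]
  · have h1 : δ ≤ ‖φ.divX.eval x‖ := hR hx
    have h2 : φ.eval x = φ.divX.eval x * x + φ.coeff 0 := by
      conv_lhs => rw [← Polynomial.divX_mul_X_add φ]
      simp
    have h3 : δ * ‖x‖ ≤ (1 + |φ.coeff 0|) * (1 + ‖φ.eval x‖) := by
      have h4 : ‖φ.divX.eval x‖ * ‖x‖ ≤ ‖φ.eval x‖ + |φ.coeff 0| := by
        rw [← norm_mul, ← Real.norm_eq_abs (φ.coeff 0)]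
        have : φ.divX.eval x * x = φ.eval x - φ.coeff 0 := by rw [h2]; ring
        rw [this]
        exact norm_sub_le _ _
      nlinarith [abs_nonneg (φ.coeff 0), norm_nonneg x,
        mul_le_mul_of_nonneg_right h1 (norm_nonneg x), mul_nonneg (abs_nonneg (φ.coeff 0)) hn]
    have h5 : ‖x‖ ≤ (1 + |φ.coeff 0|) / δ * (1 + ‖φ.eval x‖) := by
      rw [div_mul_eq_mul_div, le_div_iff₀ hδ]
      linarith
    nlinarith [abs_nonneg M, mul_nonneg (abs_nonneg M) (by linarith : 0 ≤ 1 + ‖φ.eval x‖)]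

/-- The composition operator `C_φ : f ↦ f ∘ φ` on the space `𝓢(ℝ, ℂ)` of complex-valued Schwartz
functions on `ℝ`, for a nonconstant real polynomial `φ`. -/
noncomputable def compositionOperator (φ : ℝ[X]) (hφ : 1 ≤ φ.natDegree) :
    𝓢(ℝ, ℂ) →L[ℂ] 𝓢(ℝ, ℂ) :=
  SchwartzMap.compCLM ℂ φ.hasTemperateGrowth_eval (φ.exists_norm_le_of_one_le_natDegree hφ)

theorem compositionOperator_apply (φ : ℝ[X]) (hφ : 1 ≤ φ.natDegree) (f : 𝓢(ℝ, ℂ)) (x : ℝ) :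
    compositionOperator φ hφ f x = f (φ.eval x) := rfl

/-!
Write `φ^[n]` for the iterates of `φ`. As `φ` has degree at least two, orbits that leave a large
ball tend to infinity very fast (`Polynomial.exists_escapeRadius`).

*A fixed point excludes both ergodic properties.* The set `E` of points with unbounded orbit is
open, contains all large points and misses the fixed point, so it has a boundary point `x₀`, whose
orbit stays in the ball `[-R, R]`. For a smooth bump function `f` equal to `1` on this ball,
`f ∘ φ^[n]` is `1` at `x₀` and tends to `0` at every point of `E`
(`exists_schwartzMap_of_eval_eq`). If the operator were power bounded, the functions `f ∘ φ^[n]`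
would be uniformly Lipschitz; if it were mean ergodic, the Cesàro limit of `f` would be a continuous
function equal to `1` at `x₀` and to `0` on `E`. Both are
absurd. A polynomial without fixed points has even degree, since otherwise `φ - X` has a real root.

*Without fixed points, `f ∘ φ^[n]` tends to `0` in the Schwartz space, uniformly enough to give
equicontinuity.* All orbits leave the ball before a common time `N`
(`Polynomial.exists_le_abs_iterate_eval_of_forall_eval_ne`). From then on each step raises
`|φ^[n] x|` to about the power `d = φ.natDegree`. On complex points `z` within distance `1` of `x`
the iterate `φ^[n] z` also grows by at most a `d`-th power in each step. Hence `|φ^[n] z|` and `|x|`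
are at most a power of `|φ^[n] x|` whose exponent is independent of `n`
(`Polynomial.exists_norm_iterate_eval_map_le`). Cauchy's estimate turns this into a bound of the
same kind for all derivatives of `φ^[n]`, with no need to differentiate an iterated composition, and
the decay of `f` absorbs these powers (`exists_seminorm_compositionOperator_pow_le`).
-/

/-! ### Growth of polynomials and of their iterates -/

theorem Polynomial.norm_eval_le_sum_norm_coeff_mul {𝕜 : Type*} [NormedField 𝕜] (p : 𝕜[X]) {d : ℕ}
    (hp : p.natDegree ≤ d) (z : 𝕜) :
    ‖p.eval z‖ ≤ (∑ i ∈ Finset.range (d + 1), ‖p.coeff i‖) * max 1 ‖z‖ ^ d := by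
  rw [Polynomial.eval_eq_sum_range' (Nat.lt_succ_of_le hp), Finset.sum_mul]
  refine (norm_sum_le _ _).trans (Finset.sum_le_sum fun i hi => ?_)
  rw [norm_mul, norm_pow]
  have h1 : i ≤ d := Nat.lt_succ_iff.mp (Finset.mem_range.mp hi)
  have h2 : ‖z‖ ^ i ≤ max 1 ‖z‖ ^ d :=
    (pow_le_pow_left₀ (norm_nonneg z) (le_max_right _ _) i).trans
      (pow_le_pow_right₀ (le_max_left _ _) h1)
  gcongr

/-- Iterating a polynomial of degree `d ≥ 2` raises the size of a point, suitably rescaled, at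
most to the power `d` in each step. -/
theorem Polynomial.exists_mul_max_norm_iterate_eval_le {𝕜 : Type*} [NormedField 𝕜] (p : 𝕜[X])
    (hp : 2 ≤ p.natDegree) :
    ∃ A : ℝ, 1 ≤ A ∧ ∀ (n : ℕ) (z : 𝕜),
      A * max 1 ‖(fun w => p.eval w)^[n] z‖ ≤ (A * max 1 ‖z‖) ^ p.natDegree ^ n := by
  set d := p.natDegree with hd
  set S : ℝ := ∑ i ∈ Finset.range (d + 1), ‖p.coeff i‖
  refine ⟨max 1 S, le_max_left _ _, fun n => ?_⟩
  set A := max 1 S with hA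
  have hA1 : 1 ≤ A := le_max_left _ _
  have hstep : ∀ z : 𝕜, A * max 1 ‖p.eval z‖ ≤ (A * max 1 ‖z‖) ^ d := by
    intro z
    have hz : (1 : ℝ) ≤ max 1 ‖z‖ ^ d := one_le_pow₀ (le_max_left _ _)
    have h1 : max 1 ‖p.eval z‖ ≤ A * max 1 ‖z‖ ^ d := by
      refine max_le (one_le_mul_of_one_le_of_one_le hA1 hz) ?_
      refine (p.norm_eval_le_sum_norm_coeff_mul hd.symm.le z).trans ?_
      gcongr
      exact le_max_right _ _
    calc A * max 1 ‖p.eval z‖ ≤ A * (A * max 1 ‖z‖ ^ d) := by gcongr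
      _ = A ^ 2 * max 1 ‖z‖ ^ d := by ring
      _ ≤ A ^ d * max 1 ‖z‖ ^ d := by gcongr
      _ = _ := (mul_pow _ _ _).symm
  induction n with
  | zero => intro z; simp
  | succ n ih =>
    intro z
    rw [Function.iterate_succ_apply', pow_succ, pow_mul]
    exact (hstep _).trans (pow_le_pow_left₀ (by positivity) (ih z) d)

/-- Far from the origin, a real polynomial of degree `d ≥ 2` raises the size of a point, suitably
rescaled, at least to the power `d`. -/
theorem Polynomial.exists_mul_abs_pow_le_mul_abs_eval (φ : ℝ[X]) (hφ : 2 ≤ φ.natDegree) :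
    ∃ b R : ℝ, 0 < b ∧ b ≤ 1 ∧ 2 ≤ b * R ∧
      ∀ y : ℝ, R ≤ |y| → (b * |y|) ^ φ.natDegree ≤ b * |φ.eval y| := by
  obtain ⟨d, hd⟩ : ∃ d, φ.natDegree = d + 1 := ⟨φ.natDegree - 1, by omega⟩
  have ha : 0 < |φ.leadingCoeff| := by
    rw [abs_pos, Ne, Polynomial.leadingCoeff_eq_zero]
    rintro rfl
    simp at hφ
  set a := |φ.leadingCoeff|
  set S : ℝ := ∑ i ∈ Finset.range (d + 1), ‖φ.eraseLead.coeff i‖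
  set b : ℝ := min 1 (a / 2)
  have hb : 0 < b := lt_min one_pos (by positivity)
  have hb1 : b ≤ 1 := min_le_left _ _
  refine ⟨b, max (2 / b) (2 * S / a), hb, hb1, ?_, fun y hy => ?_⟩
  · calc (2 : ℝ) = b * (2 / b) := by field_simp
      _ ≤ _ := by gcongr; exact le_max_left _ _
  · have hy2 : 2 / b ≤ |y| := (le_max_left _ _).trans hy
    have hyS : 2 * S / a ≤ |y| := (le_max_right _ _).trans hy
    have hy1 : 1 ≤ |y| := by
      refine le_trans ?_ hy2
      rw [le_div_iff₀ hb]; linarith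
    have h1 : |φ.eraseLead.eval y| ≤ S * |y| ^ d := by
      have := φ.eraseLead.norm_eval_le_sum_norm_coeff_mul (d := d)
        (φ.eraseLead_natDegree_le.trans (by omega)) y
      rwa [Real.norm_eq_abs, Real.norm_eq_abs, max_eq_right hy1] at this
    have h2 : φ.eval y = φ.eraseLead.eval y + φ.leadingCoeff * y ^ (d + 1) := by
      conv_lhs => rw [← φ.eraseLead_add_monomial_natDegree_leadingCoeff]
      rw [Polynomial.eval_add, Polynomial.eval_monomial, hd]
    have h3 : a * |y| ^ (d + 1) ≤ |φ.eval y| + S * |y| ^ d := by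
      calc a * |y| ^ (d + 1) = |φ.eval y - φ.eraseLead.eval y| := by
            rw [h2, add_sub_cancel_left, abs_mul, abs_pow]
        _ ≤ |φ.eval y| + |φ.eraseLead.eval y| := abs_sub _ _
        _ ≤ _ := by gcongr
    have h4 : S * |y| ^ d ≤ a / 2 * |y| ^ (d + 1) := by
      rw [div_le_iff₀ ha] at hyS
      rw [pow_succ, mul_comm (|y| ^ d), ← mul_assoc]
      gcongr
      linarith
    have h5 : b * |y| ^ (d + 1) ≤ |φ.eval y| := by
      have : b * |y| ^ (d + 1) ≤ a / 2 * |y| ^ (d + 1) := by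
        gcongr; exact min_le_right _ _
      linarith
    rw [hd]
    calc (b * |y|) ^ (d + 1) = b ^ (d + 1) * |y| ^ (d + 1) := mul_pow _ _ _
      _ ≤ b ^ 2 * |y| ^ (d + 1) := by
        gcongr ?_ * _
        exact pow_le_pow_of_le_one hb.le hb1 (by omega)
      _ = b * (b * |y| ^ (d + 1)) := by ring
      _ ≤ _ := by gcongr

/-- Iterated form of `Polynomial.exists_mul_abs_pow_le_mul_abs_eval`: points outside
the escape radius `R` stay outside, and
their rescaled size is raised at least to the power `φ.natDegree` in each step. -/
theorem Polynomial.exists_escapeRadius (φ : ℝ[X]) (hφ : 2 ≤ φ.natDegree) :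
    ∃ b R : ℝ, 0 < b ∧ b ≤ 1 ∧ 2 ≤ b * R ∧ ∀ (n : ℕ) (y : ℝ), R ≤ |y| →
      R ≤ |(fun x => φ.eval x)^[n] y| ∧
        (b * |y|) ^ φ.natDegree ^ n ≤ b * |(fun x => φ.eval x)^[n] y| := by
  obtain ⟨b, R, hb, hb1, hR, h⟩ := φ.exists_mul_abs_pow_le_mul_abs_eval hφ
  refine ⟨b, R, hb, hb1, hR, fun n y hy => ?_⟩
  induction n with
  | zero => simpa using hy
  | succ n ih =>
    obtain ⟨ih1, ih2⟩ := ih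
    rw [Function.iterate_succ_apply']
    set w := (fun x => φ.eval x)^[n] y
    have hw : 1 ≤ b * |w| := by nlinarith
    have h1 := h w ih1
    refine ⟨?_, ?_⟩
    · have : b * |w| ≤ b * |φ.eval w| := (le_self_pow₀ hw (by omega)).trans h1
      exact ih1.trans (le_of_mul_le_mul_left this hb)
    · rw [pow_succ, pow_mul]
      exact (pow_le_pow_left₀ (by positivity) ih2 _).trans h1

/-- Without fixed points, every orbit has left the ball of radius `R` after a time that does not
depend on the starting point: on that ball `φ x - x` has constant sign and is bounded away from
zero. -/
theorem Polynomial.exists_le_abs_iterate_eval_of_forall_eval_ne (φ : ℝ[X])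
    (h : ∀ x : ℝ, φ.eval x ≠ x) {R : ℝ} (hR : ∀ (n : ℕ) (y : ℝ), R ≤ |y| →
      R ≤ |(fun x => φ.eval x)^[n] y|) :
    ∃ N : ℕ, ∀ x : ℝ, R ≤ |(fun x => φ.eval x)^[N] x| := by
  have hcont : Continuous fun x : ℝ => φ.eval x - x := φ.continuous.sub continuous_id
  -- the sign of the displacement is recorded as `s`
  obtain ⟨s, hs, hpos⟩ : ∃ s : ℝ, |s| = 1 ∧ ∀ x, 0 < s * (φ.eval x - x) := by
    by_cases h0 : 0 < φ.eval 0 - (0 : ℝ)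
    · refine ⟨1, abs_one, fun x => ?_⟩
      by_contra! hx
      obtain ⟨c, hc⟩ := mem_range_of_exists_le_of_exists_ge hcont ⟨x, by simpa using hx⟩ ⟨0, h0.le⟩
      exact h c (sub_eq_zero.mp hc)
    · refine ⟨-1, by simp, fun x => ?_⟩
      by_contra! hx
      obtain ⟨c, hc⟩ := mem_range_of_exists_le_of_exists_ge hcont ⟨0, not_lt.mp h0⟩
        ⟨x, by linarith⟩
      exact h c (sub_eq_zero.mp hc)
  obtain ⟨δ, hδ, hδle⟩ : ∃ δ : ℝ, 0 < δ ∧ ∀ x, |x| ≤ R → δ ≤ s * (φ.eval x - x) := by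
    rcases (Metric.closedBall (0 : ℝ) R).eq_empty_or_nonempty with he | hne
    · refine ⟨1, one_pos, fun x hx => ?_⟩
      have : x ∈ Metric.closedBall (0 : ℝ) R := by simpa using hx
      simp [he] at this
    · obtain ⟨x₀, -, hx₀⟩ := (isCompact_closedBall (0 : ℝ) R).exists_isMinOn hne
        (continuous_const.mul hcont (f := fun _ => s)).continuousOn
      exact ⟨_, hpos x₀, fun x hx => hx₀ (by simpa using hx)⟩
  obtain ⟨N, hN⟩ := exists_nat_gt (2 * R / δ)
  rw [div_lt_iff₀ hδ] at hN
  refine ⟨N, fun x => ?_⟩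
  by_contra! hx
  -- the orbit has been inside the ball at all earlier times
  have hin : ∀ n ≤ N, |(fun x => φ.eval x)^[n] x| < R := by
    intro n hn
    by_contra! hc
    have := hR (N - n) _ hc
    rw [← Function.iterate_add_apply, Nat.sub_add_cancel hn] at this
    linarith
  have hmove : ∀ n ≤ N, n * δ ≤ s * ((fun x => φ.eval x)^[n] x - x) := by
    intro n hn
    induction n with
    | zero => simp
    | succ n ih =>
      have h1 := ih (by omega)
      have h2 := hδle _ (hin n (by omega)).le
      rw [Function.iterate_succ_apply']
      push_cast
      linarith
  have h1 := hmove N le_rfl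
  have h2 : s * ((fun x => φ.eval x)^[N] x - x) ≤ |(fun x => φ.eval x)^[N] x| + |x| := by
    refine (le_abs_self _).trans ?_
    rw [abs_mul, hs, one_mul]
    exact abs_sub _ _
  have h3 : |x| < R := by simpa using hin 0 (Nat.zero_le _)
  linarith

/-! ### Uniform control of the iterates of a polynomial without fixed points -/

/-- If `φ` has no fixed points then, from some time `N` on, a fixed power of the (rescaled) size of
`φ^[n] x` dominates both `x` and all values of the complexified iterate on the unit disc
around `x`. The exponent `q` does not depend on `n`: after time `N` the size of the real orbit grows
at least, and that of the complex orbit at most, by the power `φ.natDegree` in each step, so that it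
suffices to compare the two sides at time `N`. -/
theorem Polynomial.exists_norm_iterate_eval_map_le (φ : ℝ[X]) (hφ : 2 ≤ φ.natDegree)
    (h : ∀ x : ℝ, φ.eval x ≠ x) :
    ∃ (b : ℝ) (N q : ℕ), 0 < b ∧ b ≤ 1 ∧ ∀ (m : ℕ) (x : ℝ),
      (m + 1 : ℝ) ≤ b * |(fun x => φ.eval x)^[N + m] x| ∧
      |x| ≤ (b * |(fun x => φ.eval x)^[N + m] x|) ^ q ∧
      ∀ z : ℂ, ‖z - x‖ ≤ 1 →
        ‖(fun w => (φ.map (algebraMap ℝ ℂ)).eval w)^[N + m] z‖ ≤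
          (b * |(fun x => φ.eval x)^[N + m] x|) ^ q := by
  obtain ⟨b, R, hb, hb1, hR, hlow⟩ := φ.exists_escapeRadius hφ
  obtain ⟨N, hN⟩ := φ.exists_le_abs_iterate_eval_of_forall_eval_ne h fun n y hy => (hlow n y hy).1
  have hdeg : (φ.map (algebraMap ℝ ℂ)).natDegree = φ.natDegree := φ.natDegree_map _
  obtain ⟨A, hA, hup⟩ := (φ.map (algebraMap ℝ ℂ)).exists_mul_max_norm_iterate_eval_le
    (hdeg.symm ▸ hφ)
  rw [hdeg] at hup
  set d := φ.natDegree with hd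
  obtain ⟨k, C, hC⟩ := (φ.comp^[N] Polynomial.X).exists_norm_le_of_one_le_natDegree (by
    rw [Polynomial.natDegree_iterate_comp, Polynomial.natDegree_X, mul_one]
    exact Nat.one_le_pow _ _ (by omega))
  simp only [Polynomial.iterate_comp_eval, Polynomial.eval_X, Real.norm_eq_abs] at hC
  obtain ⟨s, hs⟩ := pow_unbounded_of_one_lt (A * (2 + |C| * (1 + 1 / b) ^ k))
    (one_lt_two (α := ℝ))
  refine ⟨b, N, (s + k) * d ^ N, hb, hb1, fun m x => ?_⟩
  set y := (fun x => φ.eval x)^[N] x with hy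
  have hyR : R ≤ |y| := hN x
  set τ := b * |y| with hτ
  have hτ2 : 2 ≤ τ := by nlinarith
  have hτ1 : 1 ≤ τ := by linarith
  -- comparison at time `N`: `x` is polynomially bounded by `y`, and `τ ≥ 2` absorbs constants
  have hx : A * (2 + |x|) ≤ τ ^ (s + k) := by
    have h1 : 1 + |y| ≤ (1 + 1 / b) * τ := by
      have : (1 + 1 / b) * τ = τ + |y| := by rw [hτ]; field_simp
      linarith
    have h2 : |x| ≤ |C| * (1 + 1 / b) ^ k * τ ^ k := by
      calc |x| ≤ C * (1 + |y|) ^ k := hC x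
        _ ≤ |C| * ((1 + 1 / b) * τ) ^ k := by
          gcongr; exact le_abs_self C
        _ = _ := by rw [mul_pow]; ring
    have h3 : 1 ≤ τ ^ k := one_le_pow₀ hτ1
    calc A * (2 + |x|) ≤ A * (2 * τ ^ k + |C| * (1 + 1 / b) ^ k * τ ^ k) := by gcongr; linarith
      _ = A * (2 + |C| * (1 + 1 / b) ^ k) * τ ^ k := by ring
      _ ≤ 2 ^ s * τ ^ k := by gcongr
      _ ≤ τ ^ s * τ ^ k := by gcongr
      _ = _ := (pow_add _ _ _).symm
  have hnm : (fun x => φ.eval x)^[N + m] x = (fun x => φ.eval x)^[m] y := by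
    rw [add_comm, Function.iterate_add_apply]
  rw [hnm]
  set t := b * |(fun x => φ.eval x)^[m] y| with ht
  have hτt : τ ^ d ^ m ≤ t := (hlow m y hyR).2
  have key : τ ^ ((s + k) * d ^ N * d ^ m) ≤ t ^ ((s + k) * d ^ N) := by
    rw [mul_comm, pow_mul]
    exact pow_le_pow_left₀ (by positivity) hτt _
  refine ⟨?_, ?_, fun z hz => ?_⟩
  · refine le_trans ?_ hτt
    calc (m + 1 : ℝ) ≤ 2 ^ m := by exact_mod_cast Nat.lt_two_pow_self
      _ ≤ 2 ^ d ^ m := pow_le_pow_right₀ one_le_two (Nat.lt_pow_self (by omega)).le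
      _ ≤ τ ^ d ^ m := by gcongr
  · refine le_trans ?_ key
    calc |x| ≤ A * (2 + |x|) := by nlinarith [abs_nonneg x]
      _ ≤ τ ^ (s + k) := hx
      _ ≤ _ := by
        apply pow_le_pow_right₀ hτ1
        rw [mul_assoc]
        exact Nat.le_mul_of_pos_right _ (by positivity)
  · have hzx : max 1 ‖z‖ ≤ 2 + |x| := by
      refine max_le (by linarith [abs_nonneg x]) ?_
      calc ‖z‖ = ‖(z - x) + x‖ := by rw [sub_add_cancel]
        _ ≤ ‖z - x‖ + ‖(x : ℂ)‖ := norm_add_le _ _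
        _ ≤ _ := by rw [Complex.norm_real, Real.norm_eq_abs]; linarith
    refine le_trans ?_ key
    calc _ ≤ A * max 1 ‖(fun w => (φ.map (algebraMap ℝ ℂ)).eval w)^[N + m] z‖ := by
          refine (le_max_right 1 _).trans (le_mul_of_one_le_left (by positivity) hA)
      _ ≤ (A * max 1 ‖z‖) ^ d ^ (N + m) := hup _ z
      _ ≤ (τ ^ (s + k)) ^ d ^ (N + m) := by
        gcongr
        exact le_trans (by gcongr) hx
      _ = _ := by rw [← pow_mul, pow_add, mul_assoc]

/-- The Cauchy estimate for a real polynomial, in terms of its complexification on a unit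
disc. -/
theorem Polynomial.norm_iteratedFDeriv_eval_le (p : ℝ[X]) (x : ℝ) {C : ℝ}
    (hC : ∀ z : ℂ, ‖z - x‖ ≤ 1 → ‖(p.map (algebraMap ℝ ℂ)).eval z‖ ≤ C) (i : ℕ) :
    ‖iteratedFDeriv ℝ i (fun y : ℝ => p.eval y) x‖ ≤ i.factorial * C := by
  have hiter : ∀ {𝕜 : Type} [NontriviallyNormedField 𝕜] (q : 𝕜[X]) (n : ℕ),
      iteratedDeriv n (fun y => q.eval y) = fun y => (Polynomial.derivative^[n] q).eval y := by
    intro 𝕜 _ q n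
    induction n with
    | zero => simp
    | succ n ih =>
      rw [iteratedDeriv_succ, ih, Function.iterate_succ_apply']
      ext y
      exact Polynomial.deriv _
  have h1 := Complex.norm_iteratedDeriv_le_of_forall_mem_sphere_norm_le (c := (x : ℂ)) (R := 1)
    (C := C) (f := fun z => (p.map (algebraMap ℝ ℂ)).eval z) i one_pos
    (p.map (algebraMap ℝ ℂ)).differentiable.diffContOnCl
    (fun z hz => hC z (by simpa [dist_eq_norm] using (le_of_eq hz)))
  rw [hiter, Polynomial.iterate_derivative_map] at h1
  rw [norm_iteratedFDeriv_eq_norm_iteratedDeriv, hiter]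
  have h2 : ((Polynomial.derivative^[i] p).map (algebraMap ℝ ℂ)).eval (x : ℂ)
      = ((Polynomial.derivative^[i] p).eval x : ℝ) :=
    Polynomial.eval_map_apply (algebraMap ℝ ℂ) x
  simpa [h2] using h1

/-! ### Iterates of the composition operator -/

theorem compositionOperator_pow_apply (φ : ℝ[X]) (hφ : 1 ≤ φ.natDegree) (n : ℕ) (f : 𝓢(ℝ, ℂ))
    (x : ℝ) :
    (compositionOperator φ hφ ^ n) f x = f ((fun y => φ.eval y)^[n] x) := by
  induction n generalizing x with
  | zero => rfl
  | succ n ih =>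
    rw [pow_succ', Function.iterate_succ_apply]
    exact ih _

/-- If `φ` has no fixed points, the seminorms of `f ∘ φ^[N + m]` decay like `1 / (m + 1)`, with a
constant that is a continuous seminorm of `f`. -/
theorem exists_seminorm_compositionOperator_pow_le (φ : ℝ[X]) (hφ : 2 ≤ φ.natDegree)
    (h : ∀ x : ℝ, φ.eval x ≠ x) :
    ∃ N : ℕ, ∀ i : ℕ × ℕ, ∃ p : Seminorm ℂ 𝓢(ℝ, ℂ), Continuous p ∧ ∀ (m : ℕ) (f : 𝓢(ℝ, ℂ)),
      schwartzSeminormFamily ℂ ℝ ℂ i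
        ((compositionOperator φ (one_le_two.trans hφ) ^ (N + m)) f) ≤ p f / (m + 1) := by
  obtain ⟨b, N, q, hb, hb1, H⟩ := φ.exists_norm_iterate_eval_map_le hφ h
  refine ⟨N, fun ⟨k, j⟩ => ?_⟩
  -- the decay of order `L` of the derivatives of `f` absorbs the powers of `t` and leaves `1 / t`
  set L : ℕ := q * k + q * j + 1 with hL
  set s : Finset (ℕ × ℕ) := Finset.Iic (L, j)
  set K : NNReal := (j.factorial : NNReal) * 2 ^ L * (j.factorial : NNReal) ^ j with hK
  refine ⟨K • s.sup (schwartzSeminormFamily ℂ ℝ ℂ), ?_, fun m f => ?_⟩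
  · have : Continuous ⇑(s.sup (schwartzSeminormFamily ℂ ℝ ℂ)) :=
      Seminorm.continuous_finsetSup fun i _ =>
        (schwartz_withSeminorms ℂ ℝ ℂ).continuous_seminorm i
    exact this.const_smul K
  · set S : ℝ := s.sup (schwartzSeminormFamily ℂ ℝ ℂ) f with hS
    have hS0 : 0 ≤ S := apply_nonneg _ _
    change _ ≤ (K : ℝ) * S / (m + 1)
    refine SchwartzMap.seminorm_le_bound ℂ k j _ (by positivity) fun x => ?_
    obtain ⟨h1, h2, h3⟩ := H m x
    set P : ℝ[X] := φ.comp^[N + m] Polynomial.X with hP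
    have hPeval : ∀ y, (fun y => φ.eval y)^[N + m] y = P.eval y := fun y => by
      rw [hP, Polynomial.iterate_comp_eval, Polynomial.eval_X]
    have hPevalC : ∀ z : ℂ, (fun w => (φ.map (algebraMap ℝ ℂ)).eval w)^[N + m] z
        = (P.map (algebraMap ℝ ℂ)).eval z := fun z => by
      rw [hP, Polynomial.eval_map, Polynomial.iterate_comp_eval₂, Polynomial.eval₂_X]
      simp only [Polynomial.eval_map]
    simp only [hPevalC] at h3
    rw [hPeval] at h1 h2 h3
    have hfun : ⇑((compositionOperator φ (one_le_two.trans hφ) ^ (N + m)) f)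
        = f ∘ fun y => P.eval y := by
      ext y
      rw [compositionOperator_pow_apply, hPeval, Function.comp_apply]
    rw [hfun]
    set t : ℝ := b * |P.eval x| with ht
    have hm : (0 : ℝ) < m + 1 := by positivity
    have ht1 : 1 ≤ t := le_trans (by linarith [(m.cast_nonneg : (0 : ℝ) ≤ m)]) h1
    have ht0 : 0 < t := by linarith
    have hD1 : 1 ≤ (j.factorial : ℝ) * t ^ q :=
      one_le_mul_of_one_le_of_one_le (by exact_mod_cast j.factorial_pos) (one_le_pow₀ ht1)
    have hcomp : ‖iteratedFDeriv ℝ j (f ∘ fun y => P.eval y) x‖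
        ≤ j.factorial * (2 ^ L * S / t ^ L) * ((j.factorial : ℝ) * t ^ q) ^ j := by
      refine norm_iteratedFDeriv_comp_le (N := j) (f.smooth j)
        (f := fun y => P.eval y) (P.contDiff_aeval j) le_rfl x (fun i hi => ?_) fun i hi1 hi => ?_
      · rw [le_div_iff₀ (by positivity), mul_comm]
        refine le_trans ?_ (SchwartzMap.one_add_le_sup_seminorm_apply (𝕜 := ℂ) (m := (L, j))
          le_rfl hi f (P.eval x))
        gcongr
        rw [ht, Real.norm_eq_abs]
        nlinarith [abs_nonneg (P.eval x)]
      · refine (P.norm_iteratedFDeriv_eval_le x h3 i).trans ?_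
        refine le_trans ?_ (le_self_pow₀ hD1 (by omega))
        gcongr
    have hkey : t ^ (q * k) * (1 / t ^ L) * t ^ (q * j) = 1 / t := by
      rw [hL, pow_succ, pow_add]
      field_simp
    calc ‖x‖ ^ k * ‖iteratedFDeriv ℝ j (f ∘ fun y => P.eval y) x‖
        ≤ (t ^ q) ^ k * (j.factorial * (2 ^ L * S / t ^ L) * ((j.factorial : ℝ) * t ^ q) ^ j) := by
          gcongr
          exact h2
      _ = K * S * (t ^ (q * k) * (1 / t ^ L) * t ^ (q * j)) := by
          clear_value t
          rw [hK, mul_pow, ← pow_mul, ← pow_mul]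
          push_cast
          ring
      _ = K * S / t := by rw [hkey]; ring
      _ ≤ K * S / (m + 1) := by gcongr

theorem cesaroMean_eq_sum_range {𝕜 X : Type*} [RCLike 𝕜] [AddCommGroup X] [Module 𝕜 X]
    [TopologicalSpace X] (T : X →L[𝕜] X) (n : ℕ) (x : X) :
    cesaroMean T n x = (n : 𝕜)⁻¹ • ∑ k ∈ Finset.range n, (T ^ (k + 1)) x := by
  rw [cesaroMean, Finset.range_eq_Ico, Finset.sum_Ico_add' (fun k => (T ^ k) x)]
  rfl

/-! ### Absence of fixed points implies power boundedness and mean ergodicity -/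

theorem isPowerBounded_compositionOperator (φ : ℝ[X]) (hφ : 2 ≤ φ.natDegree)
    (h : ∀ x : ℝ, φ.eval x ≠ x) :
    IsPowerBounded (compositionOperator φ (one_le_two.trans hφ)) := by
  set T := compositionOperator φ (one_le_two.trans hφ)
  obtain ⟨N, hN⟩ := exists_seminorm_compositionOperator_pow_le φ hφ h
  refine ((schwartz_withSeminorms ℂ ℝ ℂ).equicontinuous_TFAE
    fun n : ℕ => ((T ^ n : 𝓢(ℝ, ℂ) →L[ℂ] 𝓢(ℝ, ℂ)) : 𝓢(ℝ, ℂ) →ₗ[ℂ] 𝓢(ℝ, ℂ))).out 3 1 |>.mp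
    fun i => ?_
  obtain ⟨p, hp, hle⟩ := hN i
  -- the finitely many powers below `N` are dominated by a supremum of continuous seminorms
  let r : ℕ → Seminorm ℂ 𝓢(ℝ, ℂ) := fun n =>
    (schwartzSeminormFamily ℂ ℝ ℂ i).comp (T ^ n : 𝓢(ℝ, ℂ) →L[ℂ] 𝓢(ℝ, ℂ)).toLinearMap
  have hr : ∀ n, Continuous (r n) := fun n =>
    ((schwartz_withSeminorms ℂ ℝ ℂ).continuous_seminorm i).comp (T ^ n).continuous
  refine ⟨p ⊔ (Finset.range N).sup r, hp.sup (Seminorm.continuous_finsetSup fun n _ => hr n),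
    fun n => ?_⟩
  rcases lt_or_ge n N with hn | hn
  · exact (Finset.le_sup (f := r) (Finset.mem_range.mpr hn)).trans le_sup_right
  · refine le_trans (fun f => ?_) le_sup_left
    obtain ⟨m, rfl⟩ := Nat.exists_eq_add_of_le hn
    exact (hle m f).trans (div_le_self (apply_nonneg p f) (by simp))

theorem tendsto_compositionOperator_pow_zero (φ : ℝ[X]) (hφ : 2 ≤ φ.natDegree)
    (h : ∀ x : ℝ, φ.eval x ≠ x) (f : 𝓢(ℝ, ℂ)) (i : ℕ × ℕ) :
    Filter.Tendsto (fun n : ℕ => schwartzSeminormFamily ℂ ℝ ℂ i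
      ((compositionOperator φ (one_le_two.trans hφ) ^ n) f)) Filter.atTop (𝓝 0) := by
  obtain ⟨N, hN⟩ := exists_seminorm_compositionOperator_pow_le φ hφ h
  obtain ⟨p, -, hle⟩ := hN i
  rw [← Filter.tendsto_add_atTop_iff_nat N]
  refine squeeze_zero (fun n => apply_nonneg _ _)
    (g := fun n : ℕ => p f / (n + 1)) (fun n => by rw [add_comm n]; exact hle n f) ?_
  have := (tendsto_one_div_add_atTop_nhds_zero_nat (𝕜 := ℝ)).const_mul (p f)
  rw [mul_zero] at this
  exact this.congr fun n => mul_one_div _ _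

theorem isMeanErgodic_compositionOperator (φ : ℝ[X]) (hφ : 2 ≤ φ.natDegree)
    (h : ∀ x : ℝ, φ.eval x ≠ x) :
    IsMeanErgodic (compositionOperator φ (one_le_two.trans hφ)) := by
  refine ⟨0, fun f => ((schwartz_withSeminorms ℂ ℝ ℂ).tendsto_nhds _ _).mpr fun i ε hε => ?_⟩
  set T := compositionOperator φ (one_le_two.trans hφ)
  have h1 := (((Filter.tendsto_add_atTop_iff_nat 1).mpr
    (tendsto_compositionOperator_pow_zero φ hφ h f i))).cesaro
  filter_upwards [h1.eventually_lt_const hε] with n hn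
  refine lt_of_le_of_lt ?_ hn
  rw [zero_apply, sub_zero, cesaroMean_eq_sum_range, map_smul_eq_mul, norm_inv,
    RCLike.norm_natCast]
  gcongr
  exact Finset.le_sum_of_subadditive _ (map_zero _).le (map_add_le_add _) _ _

/-! ### Power boundedness or mean ergodicity forces every orbit to escape -/

theorem SchwartzMap.norm_sub_le_seminorm_mul (f : 𝓢(ℝ, ℂ)) (x y : ℝ) :
    ‖f y - f x‖ ≤ SchwartzMap.seminorm ℂ 0 1 f * |y - x| := by
  refine convex_univ.norm_image_sub_le_of_norm_deriv_le (fun z _ => f.differentiableAt)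
    (fun z _ => ?_) (Set.mem_univ x) (Set.mem_univ y)
  simpa using SchwartzMap.le_seminorm' ℂ 0 1 f z

/-- A Schwartz function whose values along the orbit of `x₀` are all `1`, while they tend to `0`
along orbits starting arbitrarily close to `x₀`, shows that the composition operator is not power
bounded. -/
theorem not_isPowerBounded_compositionOperator (φ : ℝ[X]) (hφ : 1 ≤ φ.natDegree) (f : 𝓢(ℝ, ℂ))
    {x₀ : ℝ} {E : Set ℝ} (hx₀ : x₀ ∈ closure E)
    (h1 : ∀ n : ℕ, f ((fun y => φ.eval y)^[n] x₀) = 1)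
    (h0 : ∀ x ∈ E, Filter.Tendsto (fun n : ℕ => f ((fun y => φ.eval y)^[n] x))
      Filter.atTop (𝓝 0)) :
    ¬ IsPowerBounded (compositionOperator φ hφ) := by
  intro hT
  set T := compositionOperator φ hφ
  have hequiv := ((schwartz_withSeminorms ℂ ℝ ℂ).equicontinuous_TFAE
    fun n : ℕ => ((T ^ n : 𝓢(ℝ, ℂ) →L[ℂ] 𝓢(ℝ, ℂ)) : 𝓢(ℝ, ℂ) →ₗ[ℂ] 𝓢(ℝ, ℂ))).out 1 3
  obtain ⟨p, -, hp⟩ := hequiv.mp hT (0, 1)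
  -- the iterates of `f` are Lipschitz with the same constant
  have hlip : ∀ x ∈ E, 1 ≤ p f * |x - x₀| := by
    intro x hx
    have h2 : Filter.Tendsto (fun n : ℕ => ‖f ((fun y => φ.eval y)^[n] x) - 1‖)
        Filter.atTop (𝓝 1) := by
      simpa using ((h0 x hx).sub_const 1).norm
    refine le_of_tendsto h2 (Filter.Eventually.of_forall fun n => ?_)
    have h3 := ((T ^ n) f).norm_sub_le_seminorm_mul x₀ x
    rw [compositionOperator_pow_apply, compositionOperator_pow_apply, h1] at h3
    exact h3.trans (mul_le_mul_of_nonneg_right (hp n f) (abs_nonneg _))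
  have hcl : x₀ ∈ {x : ℝ | 1 ≤ p f * |x - x₀|} :=
    closure_minimal hlip (isClosed_le continuous_const
      (continuous_const.mul (continuous_id.sub continuous_const).abs)) hx₀
  norm_num at hcl

/-- A Schwartz function whose values along the orbit of `x₀` are all `1`, while they tend to `0`
along orbits starting arbitrarily close to `x₀`, shows that the composition operator is not mean
ergodic: its mean would be discontinuous at `x₀`. -/
theorem not_isMeanErgodic_compositionOperator (φ : ℝ[X]) (hφ : 1 ≤ φ.natDegree) (f : 𝓢(ℝ, ℂ))
    {x₀ : ℝ} {E : Set ℝ} (hx₀ : x₀ ∈ closure E)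
    (h1 : ∀ n : ℕ, f ((fun y => φ.eval y)^[n] x₀) = 1)
    (h0 : ∀ x ∈ E, Filter.Tendsto (fun n : ℕ => f ((fun y => φ.eval y)^[n] x))
      Filter.atTop (𝓝 0)) :
    ¬ IsMeanErgodic (compositionOperator φ hφ) := by
  rintro ⟨P, hP⟩
  have hval : ∀ (x : ℝ) (l : ℂ), Filter.Tendsto (fun n : ℕ => f ((fun y => φ.eval y)^[n] x))
      Filter.atTop (𝓝 l) → P f x = l := by
    intro x l hl
    have h2 := ((((BoundedContinuousFunction.evalCLM ℂ x).comp
      (SchwartzMap.toBoundedContinuousFunctionCLM ℂ ℝ ℂ)).continuous.tendsto _).comp (hP f))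
    refine tendsto_nhds_unique h2 ?_
    refine (((Filter.tendsto_add_atTop_iff_nat 1).mpr hl).cesaro_smul).congr fun n => ?_
    change _ = cesaroMean (compositionOperator φ hφ) n f x
    rw [cesaroMean_eq_sum_range, smul_apply, sum_apply,
      Complex.real_smul, smul_eq_mul]
    simp only [compositionOperator_pow_apply]
    push_cast
    rfl
  have hx₀1 : P f x₀ = 1 := hval x₀ 1 (by simp [h1])
  have hcl : x₀ ∈ {x : ℝ | P f x = 0} :=
    closure_minimal (fun x hx => hval x 0 (h0 x hx))
      (isClosed_eq (P f).continuous continuous_const) hx₀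
  exact one_ne_zero (hx₀1.symm.trans hcl)

theorem SchwartzMap.exists_eq_one_of_abs_le {R : ℝ} (hR : 0 < R) :
    ∃ f : 𝓢(ℝ, ℂ), (∀ x, |x| ≤ R → f x = 1) ∧ ∀ x, R + 1 ≤ |x| → f x = 0 := by
  let g : ContDiffBump (0 : ℝ) := ⟨R, R + 1, hR, by linarith⟩
  have hg : HasCompactSupport fun x : ℝ => (g x : ℂ) :=
    g.hasCompactSupport.comp_left (g := ((↑) : ℝ → ℂ)) Complex.ofReal_zero
  have hg' : ContDiff ℝ ((⊤ : ℕ∞) : WithTop ℕ∞) fun x : ℝ => (g x : ℂ) :=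
    Complex.ofRealCLM.contDiff.comp g.contDiff
  refine ⟨hg.toSchwartzMap hg', fun x hx => ?_, fun x hx => ?_⟩
  · rw [HasCompactSupport.toSchwartzMap_toFun, g.one_of_mem_closedBall (by simpa using hx),
      Complex.ofReal_one]
  · rw [HasCompactSupport.toSchwartzMap_toFun, g.zero_of_le_dist (by simpa using hx),
      Complex.ofReal_zero]

/-- If `φ` has a fixed point, then the set of points with unbounded orbit has a boundary point.
The orbit of this point is bounded, and a bump function equal to `1` on it is a test
function as required in `not_isPowerBounded_compositionOperator` and
`not_isMeanErgodic_compositionOperator`. -/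
theorem exists_schwartzMap_of_eval_eq (φ : ℝ[X]) (hφ : 2 ≤ φ.natDegree) {c : ℝ}
    (hc : φ.eval c = c) :
    ∃ (f : 𝓢(ℝ, ℂ)) (E : Set ℝ), ∃ x₀ ∈ closure E,
      (∀ n : ℕ, f ((fun y => φ.eval y)^[n] x₀) = 1) ∧
      ∀ x ∈ E, Filter.Tendsto (fun n : ℕ => f ((fun y => φ.eval y)^[n] x))
        Filter.atTop (𝓝 0) := by
  obtain ⟨b, R, hb, hb1, hR, hlow⟩ := φ.exists_escapeRadius hφ
  have hR0 : 0 < R := by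
    by_contra! hcon
    nlinarith
  set E : Set ℝ := {x | ∃ n : ℕ, R < |(fun y => φ.eval y)^[n] x|} with hE
  have hcontn : ∀ n : ℕ, Continuous (fun y => φ.eval y)^[n] := fun n => φ.continuous.iterate n
  have hEopen : IsOpen E := by
    rw [hE, Set.ofPred_exists]
    exact isOpen_iUnion fun n => isOpen_lt continuous_const (hcontn n).abs
  -- orbits starting in `E` tend to infinity
  have hesc : ∀ x ∈ E, Filter.Tendsto (fun n : ℕ => |(fun y => φ.eval y)^[n] x|)
      Filter.atTop Filter.atTop := by
    rintro x ⟨n, hn⟩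
    rw [← Filter.tendsto_add_atTop_iff_nat n]
    refine Filter.tendsto_atTop_mono (fun m => ?_) tendsto_natCast_atTop_atTop
    rw [Function.iterate_add_apply]
    set w := (fun y => φ.eval y)^[n] x
    have h1 := (hlow m w hn.le).2
    have hw : 2 ≤ b * |w| := hR.trans (by gcongr)
    calc (m : ℝ) ≤ 2 ^ m := by exact_mod_cast Nat.lt_two_pow_self.le
      _ ≤ 2 ^ φ.natDegree ^ m := pow_le_pow_right₀ one_le_two (Nat.lt_pow_self (by omega)).le
      _ ≤ (b * |w|) ^ φ.natDegree ^ m := by gcongr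
      _ ≤ b * |(fun y => φ.eval y)^[m] w| := h1
      _ ≤ _ := mul_le_of_le_one_left (abs_nonneg _) hb1
  have hfix : ∀ n : ℕ, (fun y => φ.eval y)^[n] c = c := fun n => Function.iterate_fixed hc n
  have hcE : c ∉ E := fun hcE => by
    obtain ⟨n, hn⟩ := ((hesc c hcE).eventually_gt_atTop |c|).exists
    rw [hfix] at hn
    exact lt_irrefl _ hn
  obtain ⟨x₀, hx₀⟩ : (frontier E).Nonempty := by
    refine nonempty_frontier_iff.mpr ⟨⟨R + 1, 0, ?_⟩, fun hu => hcE (hu ▸ Set.mem_univ c)⟩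
    rw [Function.iterate_zero_apply, abs_of_pos (by linarith)]
    linarith
  have hx₀E : x₀ ∉ E := fun hmem => by
    rw [hEopen.frontier_eq] at hx₀
    exact hx₀.2 hmem
  obtain ⟨f, hf1, hf0⟩ := SchwartzMap.exists_eq_one_of_abs_le hR0
  refine ⟨f, E, x₀, frontier_subset_closure hx₀, fun n => hf1 _ ?_, fun x hx => ?_⟩
  · by_contra! hn
    exact hx₀E ⟨n, hn⟩
  · refine tendsto_const_nhds.congr' ?_
    filter_upwards [(hesc x hx).eventually_ge_atTop (R + 1)] with n hn
    exact (hf0 _ hn).symm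

/-! ### The parity of the degree -/

theorem Polynomial.exists_eval_eq_zero_of_odd_natDegree (p : ℝ[X]) (hp : Odd p.natDegree) :
    ∃ x : ℝ, p.eval x = 0 := by
  have hp0 : p.leadingCoeff ≠ 0 := by
    rw [Ne, Polynomial.leadingCoeff_eq_zero]
    rintro rfl
    simp at hp
  -- the polynomial `p x * p (-x)` has negative leading coefficient, so `p` changes sign
  set r : ℝ[X] := p * p.comp (-Polynomial.X) with hr
  have hlead : r.leadingCoeff < 0 := by
    rw [hr, Polynomial.leadingCoeff_mul, Polynomial.leadingCoeff_comp (by simp),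
      Polynomial.leadingCoeff_neg, Polynomial.leadingCoeff_X, hp.neg_one_pow]
    have := mul_self_pos.mpr hp0
    linarith
  have hdeg : 0 < r.degree := by
    rw [← Polynomial.natDegree_pos_iff_degree_pos, hr, Polynomial.natDegree_mul',
      Polynomial.natDegree_comp, Polynomial.natDegree_neg, Polynomial.natDegree_X]
    · have := hp.pos
      omega
    · rw [← Polynomial.leadingCoeff_mul]
      exact hlead.ne
  obtain ⟨x, hx⟩ := ((r.tendsto_atBot_of_leadingCoeff_nonpos hdeg hlead.le).eventually_lt_atBot
    0).exists
  have hx' : p.eval x * p.eval (-x) < 0 := by simpa [hr] using hx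
  rcases mul_neg_iff.mp hx' with ⟨h1, h2⟩ | ⟨h1, h2⟩
  · exact mem_range_of_exists_le_of_exists_ge p.continuous ⟨-x, h2.le⟩ ⟨x, h1.le⟩
  · exact mem_range_of_exists_le_of_exists_ge p.continuous ⟨x, h1.le⟩ ⟨-x, h2.le⟩

theorem Polynomial.even_natDegree_of_forall_eval_ne (φ : ℝ[X]) (hφ : 2 ≤ φ.natDegree)
    (h : ∀ x : ℝ, φ.eval x ≠ x) : Even φ.natDegree := by
  by_contra hodd
  rw [Nat.not_even_iff_odd] at hodd
  have hdeg : (φ - Polynomial.X).natDegree = φ.natDegree :=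
    Polynomial.natDegree_sub_eq_left_of_natDegree_lt (by rw [Polynomial.natDegree_X]; omega)
  obtain ⟨x, hx⟩ := (φ - Polynomial.X).exists_eval_eq_zero_of_odd_natDegree
    (hdeg.symm ▸ hodd)
  apply h x
  simpa [sub_eq_zero] using hx

/-! ### Characterization of power boundedness and mean ergodicity -/

theorem mainTheorem2 (φ : ℝ[X]) (hφ : 2 ≤ φ.natDegree) :
    List.TFAE [
      IsPowerBounded (compositionOperator φ (one_le_two.trans hφ)),
      IsMeanErgodic (compositionOperator φ (one_le_two.trans hφ)),
      Even φ.natDegree ∧ ∀ x : ℝ, φ.eval x ≠ x] := by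
  tfae_have 3 → 1 := fun h => isPowerBounded_compositionOperator φ hφ h.2
  tfae_have 3 → 2 := fun h => isMeanErgodic_compositionOperator φ hφ h.2
  tfae_have 1 → 3 := fun hT => by
    have h : ∀ x : ℝ, φ.eval x ≠ x := fun c hc => by
      obtain ⟨f, E, x₀, hx₀, h1, h0⟩ := exists_schwartzMap_of_eval_eq φ hφ hc
      exact not_isPowerBounded_compositionOperator φ _ f hx₀ h1 h0 hT
    exact ⟨φ.even_natDegree_of_forall_eval_ne hφ h, h⟩
  tfae_have 2 → 3 := fun hT => by
    have h : ∀ x : ℝ, φ.eval x ≠ x := fun c hc => by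
      obtain ⟨f, E, x₀, hx₀, h1, h0⟩ := exists_schwartzMap_of_eval_eq φ hφ hc
      exact not_isMeanErgodic_compositionOperator φ _ f hx₀ h1 h0 hT
    exact ⟨φ.even_natDegree_of_forall_eval_ne hφ h, h⟩
  tfae_finish
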